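/- All groups are finite. The power graph $\mathrm{Pow}(G)$ of a group $G$ is the simple graph with vertex set $G$ in which two distinct elements $x,y$ are adjacent if and only if one of them is an integer power of the other. Two vertices of a graph are closed twins if they have the same closed neighbourhood. A minimal cyclic cover of $G$ is a set $\{C_1,\dots,C_m\}$ of cyclic subgroups with $\bigcup_i C_i=G$ and $\bigcup_{i\ne j}C_i\ne G$ for every $j$. Each finite group has exactly one minimal cyclic cover: it is $\{G\}$ if $G$ is cyclic, and otherwise it is the set of all maximal cyclic subgroups of $G$. Let $\{C_1,\dots,C_m\}$ be the minimal cyclic cover of $G$. A CC-generator of $G$ is an element that generates some $C_i$, and a CCG-set of $G$ is a set $\{h_1,\dots,h_m\}$ consisting of exactly one generator of each of $C_1,\dots,C_m$. Theorem. There is a deterministic polynomial-time algorithm that, on input a graph $\Gamma$ on the vertices $0,\dots,n-1$ which is isomorphic to the power graph of some finite group (the group is not given), outputs a set $S$ of vertices such that, for every finite group $G$ and every identification of $\Gamma$ with $\mathrm{Pow}(G)$, the set $S$ is a CCG-set of $G$ up to closed twins. That is, $S=\{g_1,\dots,g_m\}$, where $m$ is the number of members of the minimal cyclic cover of $G$;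 each $g_i$ is a CC-generator or a closed twin in $\Gamma$ of a CC-generator $g_i'$; and $\{h_1,\dots,h_m\}$ is a CCG-set of $G$, where $h_i=g_i$ if $g_i$ is a CC-generator, and $h_i=g_i'$ otherwise. Here polynomial time means that, for some polynomial $p$, a random access machine reading the adjacency matrix of $\Gamma$, with addition and truncated subtraction of natural numbers as its unit-cost arithmetic, halts within $p(n)$ steps on every such $\Gamma$. -/

import Mathlib

/-! ### Power graphs, closed twins, cyclic covers -/

/-- The power graph of a group: distinct `x`, `y` are adjacent iff one is a power of the other. -/
def powerGraph (G : Type*) [Group G] : SimpleGraph G where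
  Adj x y := x ≠ y ∧ ((∃ m : ℤ, y = x ^ m) ∨ ∃ m : ℤ, x = y ^ m)
  symm := ⟨fun _ _ h => ⟨h.1.symm, h.2.symm⟩⟩
  loopless := ⟨fun _ h => h.1 rfl⟩

/-- The closed neighbourhood `N[u]`. -/
def SimpleGraph.closedNbhd {V : Type*} (X : SimpleGraph V) (u : V) : Set V :=
  insert u (X.neighborSet u)

/-- Two vertices are closed twins if their closed neighbourhoods are equal. -/
def SimpleGraph.ClosedTwins {V : Type*} (X : SimpleGraph V) (u v : V) : Prop :=
  X.closedNbhd u = X.closedNbhd v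

/-- A minimal cyclic cover: a set of cyclic subgroups whose union is `G`, such that leaving out
any one of them destroys this. In a finite group there is exactly one. -/
structure IsMinimalCyclicCover {G : Type*} [Group G] (𝒞 : Set (Subgroup G)) : Prop where
  cyclic : ∀ C ∈ 𝒞, IsCyclic C
  cover : ⋃ C ∈ 𝒞, (C : Set G) = Set.univ
  minimal : ∀ D ∈ 𝒞, ⋃ C ∈ 𝒞 \ {D}, (C : Set G) ≠ Set.univ

/-- A generator of a member of the minimal cyclic cover. -/
def IsCCGenerator {G : Type*} [Group G] (g : G) : Prop :=
  ∃ 𝒞 : Set (Subgroup G), IsMinimalCyclicCover 𝒞 ∧ Subgroup.zpowers g ∈ 𝒞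

/-- A covering cycle generating set: exactly one generator of each member of the minimal cyclic
cover. -/
def IsCCGSet {G : Type*} [Group G] (S : Set G) : Prop :=
  ∃ 𝒞 : Set (Subgroup G), IsMinimalCyclicCover 𝒞 ∧ Set.BijOn Subgroup.zpowers S 𝒞

/-- `S` is a CCG-set up to closed twins in the power graph: `h` sends the `i`-th element `g_i`
of `S` to `h_i`, which is `g_i` itself if `g_i` is a CC-generator, and otherwise a CC-generator
that is a closed twin of `g_i`; and the `h_i` are distinct and form a CCG-set. -/
def IsCCGSetUpToClosedTwins {G : Type*} [Group G] (S : Set G) : Prop :=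
  ∃ h : G → G,
    (∀ g ∈ S, IsCCGenerator g → h g = g) ∧
    (∀ g ∈ S, ¬ IsCCGenerator g →
      IsCCGenerator (h g) ∧ (powerGraph G).ClosedTwins g (h g)) ∧
    Set.InjOn h S ∧ IsCCGSet (h '' S)

/-! ### Algorithms on graphs

A random access machine with structured control flow. The input is a graph on the vertices
`0, …, n - 1`, given by the number `n` and its adjacency matrix, both read-only. The working
memory consists of arrays of natural numbers, all cells being `0` at the start; a program names
only finitely many arrays, and uses the cells of small index of an array as variables. Addition
and truncated subtraction are the only arithmetic, each at unit cost: in `t` steps numbers grow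
to at most `O(t)` bits, so that polynomial time on this machine is the usual polynomial time. -/

namespace RAM

/-- Contents of the working memory: the array name, then the index of the cell. -/
abbrev Memory := ℕ → ℕ → ℕ

/-- Expressions. `adj i j` reads the adjacency matrix, `get a i` the `i`-th cell of array `a`. -/
inductive Expr : Type
  | const (c : ℕ)
  | numVertices
  | adj (i j : Expr)
  | get (a : ℕ) (i : Expr)
  | add (x y : Expr)
  | sub (x y : Expr)

/-- Programs. A test `b` counts as true if its value is not `0`. -/
inductive Prog : Type
  | skip
  | set (a : ℕ) (i x : Expr)
  | seq (P Q : Prog)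
  | ite (b : Expr) (P Q : Prog)
  | while (b : Expr) (P : Prog)

open Classical in
/-- The entry `(i, j)` of the adjacency matrix, `0` outside the matrix. -/
noncomputable def adjEntry {n : ℕ} (X : SimpleGraph (Fin n)) (i j : ℕ) : ℕ :=
  if ∃ (hi : i < n) (hj : j < n), X.Adj ⟨i, hi⟩ ⟨j, hj⟩ then 1 else 0

/-- The value of an expression. -/
noncomputable def Expr.eval {n : ℕ} (X : SimpleGraph (Fin n)) (σ : Memory) : Expr → ℕ
  | const c => c
  | numVertices => n
  | adj i j => adjEntry X (i.eval X σ) (j.eval X σ)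
  | get a i => σ a (i.eval X σ)
  | add x y => x.eval X σ + y.eval X σ
  | sub x y => x.eval X σ - y.eval X σ

/-- The number of steps it takes to evaluate an expression: one for each operation. -/
def Expr.cost : Expr → ℕ
  | const _ => 1
  | numVertices => 1
  | adj i j => i.cost + j.cost + 1
  | get _ i => i.cost + 1
  | add x y => x.cost + y.cost + 1
  | sub x y => x.cost + y.cost + 1

/-- The memory after writing `x` into the `i`-th cell of array `a`. -/
def Memory.write (σ : Memory) (a i x : ℕ) : Memory :=
  Function.update σ a (Function.update (σ a) i x)

/-- `Exec X P σ τ t`: on input `X`, the program `P`, started with memory `σ`, halts after exactly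
`t` steps with memory `τ`. -/
inductive Exec {n : ℕ} (X : SimpleGraph (Fin n)) : Prog → Memory → Memory → ℕ → Prop
  | skip (σ) : Exec X .skip σ σ 1
  | set (a i x σ) :
      Exec X (.set a i x) σ (σ.write a (i.eval X σ) (x.eval X σ)) (i.cost + x.cost + 1)
  | seq {P Q σ τ ρ s t} (hP : Exec X P σ τ s) (hQ : Exec X Q τ ρ t) :
      Exec X (.seq P Q) σ ρ (s + t)
  | iteTrue {b P Q σ τ t} (hb : b.eval X σ ≠ 0) (hP : Exec X P σ τ t) :
      Exec X (.ite b P Q) σ τ (b.cost + t + 1)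
  | iteFalse {b P Q σ τ t} (hb : b.eval X σ = 0) (hQ : Exec X Q σ τ t) :
      Exec X (.ite b P Q) σ τ (b.cost + t + 1)
  | whileTrue {b P σ τ ρ s t} (hb : b.eval X σ ≠ 0) (hP : Exec X P σ τ s)
      (hW : Exec X (.while b P) τ ρ t) :
      Exec X (.while b P) σ ρ (b.cost + s + t + 1)
  | whileFalse {b P σ} (hb : b.eval X σ = 0) :
      Exec X (.while b P) σ σ (b.cost + 1)

/-- The machine is deterministic. In particular the output depends on the input graph alone. -/
theorem Exec.deterministic {n : ℕ} {X : SimpleGraph (Fin n)} {P : Prog} {σ τ τ' : Memory}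
    {t t' : ℕ} (h : Exec X P σ τ t) (h' : Exec X P σ τ' t') : τ = τ' ∧ t = t' := by
  induction h generalizing τ' t' with
  | skip σ => cases h'; exact ⟨rfl, rfl⟩
  | set a i x σ => cases h'; exact ⟨rfl, rfl⟩
  | seq _ _ ihP ihQ =>
    cases h' with
    | seq hP hQ =>
      obtain ⟨rfl, rfl⟩ := ihP hP
      obtain ⟨rfl, rfl⟩ := ihQ hQ
      exact ⟨rfl, rfl⟩
  | iteTrue hb _ ih =>
    cases h' with
    | iteTrue _ h => obtain ⟨rfl, rfl⟩ := ih h; exact ⟨rfl, rfl⟩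
    | iteFalse hb' _ => exact absurd hb' hb
  | iteFalse hb _ ih =>
    cases h' with
    | iteTrue hb' _ => exact absurd hb hb'
    | iteFalse _ h => obtain ⟨rfl, rfl⟩ := ih h; exact ⟨rfl, rfl⟩
  | whileTrue hb _ _ ihP ihW =>
    cases h' with
    | whileTrue _ hP hW =>
      obtain ⟨rfl, rfl⟩ := ihP hP
      obtain ⟨rfl, rfl⟩ := ihW hW
      exact ⟨rfl, rfl⟩
    | whileFalse hb' => exact absurd hb' hb
  | whileFalse hb =>
    cases h' with
    | whileTrue hb' _ _ => exact absurd hb hb'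
    | whileFalse _ => exact ⟨rfl, rfl⟩

/-- The memory at the start. -/
def Memory.initial : Memory := fun _ _ => 0

/-- The output: the set of vertices `v` that are marked by a nonzero `v`-th cell of array `0`. -/
def Memory.marked (σ : Memory) (n : ℕ) : Set (Fin n) := {v | σ 0 v ≠ 0}

end RAM

/-! If g generates a maximal cyclic subgroup, its closed neighbourhood in the power graph is exactly
⟨g⟩, so generators of different maximal cyclic subgroups are never closed twins. It therefore
suffices to pick one vertex from each twin class containing such a generator
(`isCCGSetUpToClosedTwins_of_transversal`), and the point is to recognise these classes from the
graph alone (`isCoverVertex_iff`).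

Class sizes do this. The class of g has at least φ(|g|) elements. Any other non-dominating class
meeting ⟨g⟩ lies inside it. Either it consists of the generators of one subgroup ⟨y⟩, and has φ(|y|)
≤ φ(|g|) elements, or it mixes orders. Mixing forces |g| to be a prime power, so |g| ≤ 2φ(|g|), and
what remains of ⟨g⟩ beside its generators and 1 is too small to match the class of g
(`twinCount_eq_totient_or_lt`). Hence maximal generators have locally largest classes. A non-maximal
x can tie with g only if |g| = 2|x| with |x| odd; the involution of ⟨g⟩, adjacent to g but not to x,
then has too small a class, which the tie-break detects. Cyclic groups, where the generators
dominate, are told apart by the size of the dominating class (`dominatorsPrevail_iff`).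

The resulting condition is a fixed formula with quantifiers and counting over vertices. Nested loops
evaluate it in polynomial time (`RAM.Term.compile_spec`), and the vertex of least index represents
its class. -/

namespace SimpleGraph

/-! ### Twin classes and the graph-theoretic recognition condition. -/

variable {V : Type*} (X : SimpleGraph V)

/-- A vertex adjacent to all others. -/
def Dominates (u : V) : Prop := ∀ v, v ∈ X.closedNbhd u

/-- The size of the closed twin class of a vertex. -/
noncomputable def twinCount (u : V) : ℕ := {v | X.ClosedTwins u v}.ncard

/-- Every dominating vertex has a larger twin class than every other vertex. Among power graphs of
finite groups these are the power graphs of cyclic groups. -/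
def DominatorsPrevail : Prop :=
  ∀ u y, X.Dominates u → ¬ X.Dominates y → X.twinCount y < X.twinCount u

/-- The twin class of `x` is locally maximal, with a tie-break. -/
def LocallyLargest (x : V) : Prop :=
  ∀ y ∈ X.closedNbhd x, ¬ X.Dominates y → ¬ X.ClosedTwins x y →
    X.twinCount y ≤ X.twinCount x ∧
      (X.twinCount y = X.twinCount x →
        ∀ z ∈ X.closedNbhd y, z ∉ X.closedNbhd x → X.twinCount x ≤ X.twinCount z)

/-- The condition recognising, among the vertices of a power graph, the closed twins of the
generators of maximal cyclic subgroups. -/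
def IsCoverVertex (x : V) : Prop :=
  (X.DominatorsPrevail ∧ X.Dominates x) ∨
    (¬ X.DominatorsPrevail ∧ ¬ X.Dominates x ∧ X.LocallyLargest x)

variable {X}

theorem mem_closedNbhd {u v : V} : v ∈ X.closedNbhd u ↔ v = u ∨ X.Adj u v := by
  simp [closedNbhd]

theorem mem_closedNbhd_self (u : V) : u ∈ X.closedNbhd u := by simp [closedNbhd]

theorem mem_closedNbhd_comm {u v : V} : v ∈ X.closedNbhd u ↔ u ∈ X.closedNbhd v := by
  rw [mem_closedNbhd, mem_closedNbhd, X.adj_comm, eq_comm]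

theorem ClosedTwins.twinCount_eq {u v : V} (h : X.ClosedTwins u v) :
    X.twinCount u = X.twinCount v := by
  unfold ClosedTwins at h
  simp only [twinCount, ClosedTwins, h]

theorem ClosedTwins.dominates_iff {u v : V} (h : X.ClosedTwins u v) :
    X.Dominates u ↔ X.Dominates v := by
  unfold ClosedTwins at h
  simp only [Dominates, h]

theorem Dominates.closedTwins {u v : V} (hu : X.Dominates u) (hv : X.Dominates v) :
    X.ClosedTwins u v := by
  ext w; exact ⟨fun _ => hv w, fun _ => hu w⟩

theorem ClosedTwins.locallyLargest_iff {u v : V} (h : X.ClosedTwins u v) :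
    X.LocallyLargest u ↔ X.LocallyLargest v := by
  have h' := h.twinCount_eq
  unfold ClosedTwins at h
  simp only [LocallyLargest, ClosedTwins, h, h']

end SimpleGraph

/-- The hypotheses force `n` to be a power of a prime p dividing b / a, and φ(p ^ k) = p ^ (k - 1) *
(p - 1) is at least half of p ^ k. -/
theorem Nat.le_two_mul_totient_of_same_comparable {a b n : ℕ} (hn : n ≠ 0) (ha : 1 < a)
    (hab : a ∣ b) (hbn : b ∣ n) (hne : a ≠ b)
    (h : ∀ f, f ∣ n → ((f ∣ a ∨ a ∣ f) ↔ (f ∣ b ∨ b ∣ f))) : n ≤ 2 * n.totient := by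
  have ha0 : a ≠ 0 := by omega
  obtain ⟨c, rfl⟩ := hab
  have hc : c ≠ 1 := by rintro rfl; simp at hne
  obtain ⟨p, hp, hpc⟩ := Nat.exists_prime_and_dvd hc
  have hpab : a * p ∣ a * c := Nat.mul_dvd_mul_left a hpc
  have hpn : p ∣ n := (hpc.trans (Dvd.intro_left a rfl)).trans hbn
  have key : ∀ q, q.Prime → q ∣ n → q = p := by
    intro q hq hqn
    by_contra hqp
    -- Three test divisors rule out a second prime q: a * q shows that q divides b, then q itself
    -- shows that q divides a, and finally the least power of p not dividing a is comparable with b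
    -- but not with a.
    have hcop : Nat.Coprime q p := (Nat.coprime_primes hq hp).2 hqp
    have hqb : q ∣ a * c := by
      by_contra hqb
      have hqa : ¬ q ∣ a := fun h => hqb (h.mul_right c)
      have haq : a * q ∣ n :=
        Nat.Coprime.mul_dvd_of_dvd_of_dvd ((Nat.Prime.coprime_iff_not_dvd hq).2 hqa).symm
          ((Dvd.intro c rfl).trans hbn) hqn
      rcases (h _ haq).1 (Or.inr (Dvd.intro q rfl)) with h1 | h1
      · exact hqb ((Dvd.intro_left a rfl).trans h1)
      · have : p ∣ q := Nat.dvd_of_mul_dvd_mul_left (by omega) (hpab.trans h1)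
        exact hqp ((Nat.prime_dvd_prime_iff_eq hp hq).1 this).symm
    have hqa : q ∣ a := by
      rcases (h q hqn).2 (Or.inl hqb) with h1 | h1
      · exact h1
      · rcases (Nat.dvd_prime hq).1 h1 with h2 | h2
        · omega
        · rw [h2]
    have hdvd : p ^ (a.factorization p + 1) ∣ a * c := by
      refine dvd_trans ?_ hpab
      rw [pow_succ]
      exact Nat.mul_dvd_mul_right (Nat.ordProj_dvd a p) p
    rcases (h _ (hdvd.trans hbn)).2 (Or.inl hdvd) with h1 | h1
    · exact Nat.pow_succ_factorization_not_dvd ha0 hp h1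
    · exact hqp ((Nat.prime_dvd_prime_iff_eq hq hp).1 (hq.dvd_of_dvd_pow (hqa.trans h1)))
  have hn1 := Nat.eq_prime_pow_of_unique_prime_dvd hn (fun {q} hq hqn => key q hq hqn)
  set k := n.primeFactorsList.length
  have hk : 0 < k := by
    rcases Nat.eq_zero_or_pos k with h0 | h0
    · rw [h0, pow_zero] at hn1
      rw [hn1] at hpn
      exact absurd (Nat.dvd_one.1 hpn) hp.one_lt.ne'
    · exact h0
  rw [hn1, Nat.totient_prime_pow hp hk]
  obtain ⟨j, hj⟩ : ∃ j, k = j + 1 := ⟨k - 1, by omega⟩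
  rw [hj, pow_succ, Nat.add_sub_cancel]
  have := hp.two_le
  calc p ^ j * p ≤ p ^ j * (2 * (p - 1)) := Nat.mul_le_mul_left _ (by omega)
    _ = _ := by ring

/-! ### Power graphs and maximal cyclic subgroups. -/

section PowerGraph

open Subgroup

variable {G : Type*} [Group G]

theorem mem_closedNbhd_powerGraph {x y : G} :
    y ∈ (powerGraph G).closedNbhd x ↔ y ∈ zpowers x ∨ x ∈ zpowers y := by
  simp only [SimpleGraph.mem_closedNbhd, powerGraph, mem_zpowers_iff]
  constructor
  · rintro (rfl | ⟨_, ⟨m, rfl⟩ | ⟨m, rfl⟩⟩)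
    · exact Or.inl ⟨1, by simp⟩
    · exact Or.inl ⟨m, rfl⟩
    · exact Or.inr ⟨m, rfl⟩
  · intro h
    by_cases hxy : y = x
    · exact Or.inl hxy
    · refine Or.inr ⟨fun h => hxy h.symm, h.imp ?_ ?_⟩ <;> rintro ⟨m, hm⟩ <;> exact ⟨m, hm.symm⟩

theorem closedTwins_of_zpowers_eq {x y : G} (h : zpowers x = zpowers y) :
    (powerGraph G).ClosedTwins x y := by
  have hx : ∀ w, x ∈ zpowers w ↔ y ∈ zpowers w := fun w => by
    rw [← zpowers_le, h, zpowers_le]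
  ext w
  rw [mem_closedNbhd_powerGraph, mem_closedNbhd_powerGraph, h, hx]

theorem dominates_one : (powerGraph G).Dominates 1 := fun _ =>
  mem_closedNbhd_powerGraph.2 (Or.inr (one_mem _))

/-- The cyclic subgroup generated by `g` is maximal among the cyclic subgroups. -/
def GeneratesMaximalCyclic (g : G) : Prop := ∀ k : G, g ∈ zpowers k → k ∈ zpowers g

theorem GeneratesMaximalCyclic.mem_closedNbhd_iff {g : G} (hg : GeneratesMaximalCyclic g) {x : G} :
    x ∈ (powerGraph G).closedNbhd g ↔ x ∈ zpowers g := by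
  rw [mem_closedNbhd_powerGraph]
  exact ⟨fun h => h.elim id (hg x), Or.inl⟩

theorem GeneratesMaximalCyclic.zpowers_eq {g x : G} (hg : GeneratesMaximalCyclic g)
    (h : g ∈ zpowers x) : zpowers g = zpowers x :=
  le_antisymm (zpowers_le.2 h) (zpowers_le.2 (hg x h))

theorem GeneratesMaximalCyclic.mem_of_closedTwins {g y z : G} (hg : GeneratesMaximalCyclic g)
    (hy : y ∈ zpowers g) (h : (powerGraph G).ClosedTwins y z) : z ∈ zpowers g := by
  rw [← hg.mem_closedNbhd_iff, SimpleGraph.mem_closedNbhd_comm, ← h,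
    SimpleGraph.mem_closedNbhd_comm, hg.mem_closedNbhd_iff]
  exact hy

theorem ncard_zpowers (g : G) : (zpowers g : Set G).ncard = orderOf g := by
  rw [← Nat.card_zpowers g]; rfl

theorem IsMinimalCyclicCover.generatesMaximalCyclic {𝒞 : Set (Subgroup G)}
    (h𝒞 : IsMinimalCyclicCover 𝒞) {g : G} (hg : zpowers g ∈ 𝒞) : GeneratesMaximalCyclic g := by
  intro k hk
  have hmem := h𝒞.cover.symm ▸ Set.mem_univ k
  simp only [Set.mem_iUnion] at hmem
  obtain ⟨C, hC, hkC⟩ := hmem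
  have hgC : zpowers g ≤ C := zpowers_le.2 (zpowers_le.2 hkC hk)
  by_contra hkg
  have hne : C ≠ zpowers g := by rintro rfl; exact hkg hkC
  -- If ⟨g⟩ were not maximal, another member `C` would contain it, making ⟨g⟩ redundant in the
  -- cover.
  refine h𝒞.minimal _ hg (Set.eq_univ_of_forall fun x => ?_)
  have hmem := h𝒞.cover.symm ▸ Set.mem_univ x
  simp only [Set.mem_iUnion] at hmem
  obtain ⟨D, hD, hxD⟩ := hmem
  by_cases hDg : D = zpowers g
  · exact Set.mem_biUnion ⟨hC, hne⟩ (hgC (hDg ▸ hxD))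
  · exact Set.mem_biUnion ⟨hD, hDg⟩ hxD

variable [Finite G]

/-- A cyclic group has only one subgroup of each order. Concretely, with u = g ^ i, w = g ^ j and d
= gcd(|g|, j), the order condition gives d ∣ i, and Bézout writes g ^ i as a power of g ^ j. -/
theorem mem_zpowers_of_orderOf_dvd {g u w : G} (hu : u ∈ zpowers g) (hw : w ∈ zpowers g)
    (h : orderOf u ∣ orderOf w) : u ∈ zpowers w := by
  obtain ⟨i, rfl⟩ := mem_zpowers_iff.1 hu
  obtain ⟨j, rfl⟩ := mem_zpowers_iff.1 hw
  have hn : (orderOf g : ℤ) ≠ 0 := by exact_mod_cast (orderOf_pos g).ne'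
  set d : ℤ := gcd (orderOf g : ℤ) j
  have hd : d ∣ orderOf g := gcd_dvd_left _ _
  have hd0 : d ≠ 0 := fun h0 => hn (zero_dvd_iff.1 (h0 ▸ hd))
  obtain ⟨m, hm⟩ := hd
  obtain ⟨j', hj'⟩ : d ∣ j := gcd_dvd_right _ _
  have hwm : (g ^ j) ^ m = 1 := by
    rw [← zpow_mul, ← orderOf_dvd_iff_zpow_eq_one]
    exact ⟨j', by rw [hm]; nth_rw 1 [hj']; ring⟩
  have hum : (g ^ i) ^ m = 1 := by
    rw [← orderOf_dvd_iff_zpow_eq_one] at hwm ⊢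
    exact (Int.natCast_dvd_natCast.2 h).trans hwm
  rw [← zpow_mul, ← orderOf_dvd_iff_zpow_eq_one, hm] at hum
  have hm0 : m ≠ 0 := by rintro rfl; exact hn (hm.trans (mul_zero d))
  obtain ⟨c, hc⟩ : d ∣ i := Int.dvd_of_mul_dvd_mul_right hm0 hum
  obtain ⟨a, b, hab⟩ := exists_gcd_eq_mul_add_mul (orderOf g : ℤ) j
  refine mem_zpowers_iff.2 ⟨b * c, ?_⟩
  have hi : i = orderOf g * (a * c) + j * (b * c) := by
    rw [hc, show d = _ from hab]; ring
  rw [← zpow_mul, hi, zpow_add, zpow_mul g (orderOf g), zpow_natCast, pow_orderOf_eq_one,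
    one_zpow, one_mul]

theorem mem_zpowers_iff_orderOf_dvd {g u w : G} (hu : u ∈ zpowers g) (hw : w ∈ zpowers g) :
    u ∈ zpowers w ↔ orderOf u ∣ orderOf w :=
  ⟨orderOf_dvd_of_mem_zpowers, mem_zpowers_of_orderOf_dvd hu hw⟩

theorem zpowers_eq_of_orderOf_eq {g u w : G} (hu : u ∈ zpowers g) (hw : w ∈ zpowers g)
    (h : orderOf u = orderOf w) : zpowers u = zpowers w :=
  le_antisymm (zpowers_le.2 (mem_zpowers_of_orderOf_dvd hu hw h.dvd))
    (zpowers_le.2 (mem_zpowers_of_orderOf_dvd hw hu h.symm.dvd))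

theorem exists_generatesMaximalCyclic (x : G) :
    ∃ g, GeneratesMaximalCyclic g ∧ x ∈ zpowers g := by
  obtain ⟨g, hg, hmax⟩ := Set.exists_max_image {g : G | x ∈ zpowers g} orderOf (Set.toFinite _)
    ⟨x, mem_zpowers x⟩
  refine ⟨g, fun k hk => ?_, hg⟩
  have h1 : orderOf k ≤ orderOf g := hmax k (zpowers_le.2 hk hg)
  have h2 := Nat.le_of_dvd (orderOf_pos k) (orderOf_dvd_of_mem_zpowers hk)
  exact mem_zpowers_of_orderOf_dvd (mem_zpowers k) hk (by rw [le_antisymm h1 h2])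

/-! ### Sizes of twin classes. -/

theorem ncard_generators (y : G) : {z | zpowers z = zpowers y}.ncard = (orderOf y).totient := by
  classical
  have := Fintype.ofFinite G
  have hcard : Fintype.card (zpowers y) = orderOf y := Fintype.card_zpowers
  have h := IsCyclic.card_orderOf_eq_totient (α := zpowers y) (d := orderOf y) hcard.symm.dvd
  rw [← h, ← Set.ncard_coe_finset, ← Set.ncard_image_of_injective _ Subtype.val_injective]
  congr 1
  ext z
  simp only [Set.mem_ofPred_eq, Finset.coe_filter, Finset.mem_univ, true_and, Set.mem_image,
    Subtype.exists, exists_and_right, exists_eq_right, orderOf_mk, exists_prop]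
  constructor
  · intro hz
    exact ⟨hz ▸ mem_zpowers z, by rw [← Nat.card_zpowers, hz, Nat.card_zpowers]⟩
  · rintro ⟨h1, h2⟩
    exact zpowers_eq_of_orderOf_eq h1 (mem_zpowers y) h2

theorem totient_orderOf_le_twinCount (x : G) :
    (orderOf x).totient ≤ (powerGraph G).twinCount x := by
  rw [← ncard_generators]
  exact Set.ncard_le_ncard (fun z hz => closedTwins_of_zpowers_eq (Eq.symm hz)) (Set.toFinite _)

theorem totient_orderOf_le_of_mem_zpowers {x y : G} (h : x ∈ zpowers y) :
    (orderOf x).totient ≤ (orderOf y).totient :=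
  Nat.le_of_dvd (Nat.totient_pos.2 (orderOf_pos y))
    (Nat.totient_dvd_of_dvd (orderOf_dvd_of_mem_zpowers h))

/-- If two elements of different orders are adjacent to the same vertices within a cyclic group,
then at least half of its elements are generators. -/
theorem orderOf_le_two_mul_totient {g u w : G} (hu : u ∈ zpowers g) (hw : w ∈ zpowers g)
    (hu1 : u ≠ 1) (hw1 : w ≠ 1) (hne : orderOf u ≠ orderOf w)
    (h : ∀ v ∈ zpowers g, v ∈ (powerGraph G).closedNbhd u ↔ v ∈ (powerGraph G).closedNbhd w) :
    orderOf g ≤ 2 * (orderOf g).totient := by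
  have hcomp : ∀ x ∈ zpowers g, ∀ v ∈ zpowers g, v ∈ (powerGraph G).closedNbhd x ↔
      (orderOf v ∣ orderOf x ∨ orderOf x ∣ orderOf v) := fun x hx v hv => by
    rw [mem_closedNbhd_powerGraph, mem_zpowers_iff_orderOf_dvd hx hv,
      mem_zpowers_iff_orderOf_dvd hv hx]
  have hf : ∀ f, f ∣ orderOf g → ((f ∣ orderOf u ∨ orderOf u ∣ f) ↔
      (f ∣ orderOf w ∨ orderOf w ∣ f)) := by
    intro f hf
    -- Every divisor of |g| is the order of some power of g, so equal neighbourhoods translate into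
    -- a condition on all divisors.
    have hv : g ^ (orderOf g / f) ∈ zpowers g := pow_mem (mem_zpowers g) _
    have := h _ hv
    rwa [hcomp u hu _ hv, hcomp w hw _ hv, orderOf_pow_orderOf_div (orderOf_pos g).ne' hf] at this
  have hgt : ∀ x : G, x ≠ 1 → 1 < orderOf x := fun x hx => by
    have := orderOf_pos x
    have := mt orderOf_eq_one_iff.1 hx
    omega
  have huw := (h u hu).1 (SimpleGraph.mem_closedNbhd_self u)
  rw [hcomp w hw u hu] at huw
  rcases huw with huw | huw
  · exact Nat.le_two_mul_totient_of_same_comparable (orderOf_pos g).ne' (hgt u hu1) huw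
      (orderOf_dvd_of_mem_zpowers hw) hne hf
  · exact Nat.le_two_mul_totient_of_same_comparable (orderOf_pos g).ne' (hgt w hw1) huw
      (orderOf_dvd_of_mem_zpowers hu) hne.symm (fun f h => (hf f h).symm)

/-- The alternatives are whether the class of y has a single order or several. In the second case
|g| ≤ 2φ(|g|), while 1, the generators of ⟨g⟩ and the class of y are disjoint parts of ⟨g⟩; so the
class of y has fewer than φ(|g|) elements. -/
theorem twinCount_eq_totient_or_lt {g y : G} (hg : GeneratesMaximalCyclic g) (hy : y ∈ zpowers g)
    (hdom : ¬ (powerGraph G).Dominates y) (htw : ¬ (powerGraph G).ClosedTwins g y) :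
    (powerGraph G).twinCount y = (orderOf y).totient ∨
      (powerGraph G).twinCount y < (powerGraph G).twinCount g := by
  have hone : ∀ z, (powerGraph G).ClosedTwins y z → z ≠ 1 := by
    rintro z hz rfl
    exact hdom (hz.dominates_iff.2 dominates_one)
  by_cases hplain : ∀ z, (powerGraph G).ClosedTwins y z → orderOf z = orderOf y
  · left
    rw [← ncard_generators]
    unfold SimpleGraph.twinCount
    congr 1
    ext z
    exact ⟨fun hz => zpowers_eq_of_orderOf_eq (hg.mem_of_closedTwins hy hz) hy (hplain z hz),
      fun hz => closedTwins_of_zpowers_eq (Eq.symm hz)⟩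
  · right
    push Not at hplain
    obtain ⟨z, hz, hzy⟩ := hplain
    have h2 := orderOf_le_two_mul_totient hy (hg.mem_of_closedTwins hy hz) (hone y rfl) (hone z hz)
      hzy.symm (fun v _ => by rw [hz])
    have hsub : insert 1 ({z | zpowers z = zpowers g} ∪ {z | (powerGraph G).ClosedTwins y z}) ⊆
        (zpowers g : Set G) := by
      rintro v (rfl | hv | hv)
      · exact one_mem _
      · exact (show zpowers v = zpowers g from hv) ▸ mem_zpowers v
      · exact hg.mem_of_closedTwins hy hv
    have hdisj : Disjoint {z | zpowers z = zpowers g} {z | (powerGraph G).ClosedTwins y z} :=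
      Set.disjoint_left.2 fun v hv hv' =>
        htw ((closedTwins_of_zpowers_eq (Eq.symm hv)).trans (Eq.symm hv'))
    have h1 : (1 : G) ∉ {z | zpowers z = zpowers g} ∪ {z | (powerGraph G).ClosedTwins y z} := by
      rintro (h | h)
      · rw [← show zpowers (1 : G) = zpowers g from h] at hy
        simp only [zpowers_one_eq_bot, mem_bot] at hy
        exact hone y rfl hy
      · exact hone 1 h rfl
    have hle := Set.ncard_le_ncard hsub (Set.toFinite _)
    rw [Set.ncard_insert_of_notMem h1 (Set.toFinite _), Set.ncard_union_eq hdisj, ncard_generators,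
      ncard_zpowers] at hle
    have := totient_orderOf_le_twinCount g
    change _ + (powerGraph G).twinCount y + 1 ≤ _ at hle
    omega

/-! ### Recognising generators of maximal cyclic subgroups. -/

/-- A dominating generator of a maximal cyclic subgroup generates G, so the right side says that G
is cyclic. Then the dominating class contains 1 besides the φ(|g|) generators when another class
exists, which makes the inequality strict. If G is not cyclic, the dominators lie in every maximal
⟨g⟩ and miss its generators, so they cannot outnumber the class of g. -/
theorem dominatorsPrevail_iff :
    (powerGraph G).DominatorsPrevail ↔
      ∃ g : G, GeneratesMaximalCyclic g ∧ (powerGraph G).Dominates g := by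
  constructor
  · intro h
    by_contra! hno
    obtain ⟨g, hg, -⟩ := exists_generatesMaximalCyclic (1 : G)
    have hlt := h 1 g dominates_one (hno g hg)
    have hpos : 0 < (orderOf g).totient := Nat.totient_pos.2 (orderOf_pos g)
    have hle := totient_orderOf_le_twinCount g
    by_cases hx : ∃ x : G, x ≠ 1 ∧ (powerGraph G).Dominates x
    · obtain ⟨x, hx1, hx⟩ := hx
      have hmem : ∀ z, (powerGraph G).Dominates z → z ∈ zpowers g := fun z hz => by
        rw [← hg.mem_closedNbhd_iff, SimpleGraph.mem_closedNbhd_comm]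
        exact hz g
      have h2 : orderOf g ≤ 2 * (orderOf g).totient := by
        -- Inside ⟨g⟩ both x and g are adjacent to everything, although they are not twins in G.
        refine orderOf_le_two_mul_totient (hmem x hx) (mem_zpowers g) hx1 ?_ ?_ ?_
        · rintro rfl; exact hno 1 hg dominates_one
        · intro ho
          exact hno g hg ((closedTwins_of_zpowers_eq (zpowers_eq_of_orderOf_eq (hmem x hx)
            (mem_zpowers g) ho)).dominates_iff.1 hx)
        · exact fun v hv => ⟨fun _ => hg.mem_closedNbhd_iff.2 hv, fun _ => hx v⟩
      have hdisj : Disjoint {z | zpowers z = zpowers g} {z | (powerGraph G).ClosedTwins 1 z} :=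
        Set.disjoint_left.2 fun v hv hv' =>
          hno g hg ((closedTwins_of_zpowers_eq hv).dominates_iff.1
            ((SimpleGraph.ClosedTwins.dominates_iff hv').1 dominates_one))
      have hsub : {z | zpowers z = zpowers g} ∪ {z | (powerGraph G).ClosedTwins 1 z} ⊆
          (zpowers g : Set G) := by
        rintro v (hv | hv)
        · exact (show zpowers v = zpowers g from hv) ▸ mem_zpowers v
        · exact hmem v ((SimpleGraph.ClosedTwins.dominates_iff hv).1 dominates_one)
      have hle' := Set.ncard_le_ncard hsub (Set.toFinite _)
      rw [Set.ncard_union_eq hdisj, ncard_generators, ncard_zpowers] at hle'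
      change _ + (powerGraph G).twinCount 1 ≤ _ at hle'
      omega
    · push Not at hx
      have : (powerGraph G).twinCount 1 = 1 := by
        rw [SimpleGraph.twinCount, Set.ncard_eq_one]
        refine ⟨1, Set.eq_singleton_iff_unique_mem.2 ⟨rfl, fun z hz => ?_⟩⟩
        by_contra hz1
        exact hx z hz1 ((SimpleGraph.ClosedTwins.dominates_iff hz).1 dominates_one)
      omega
  · rintro ⟨g, hg, hd⟩ u y hu hy
    have hyg : y ∈ zpowers g := hg.mem_closedNbhd_iff.1 (hd y)
    rw [(hu.closedTwins hd).twinCount_eq]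
    rcases twinCount_eq_totient_or_lt hg hyg hy (fun h => hy (h.dominates_iff.1 hd)) with h | h
    · rw [h]
      refine lt_of_le_of_lt (totient_orderOf_le_of_mem_zpowers hyg) ?_
      have h1 : (1 : G) ∉ {z | zpowers z = zpowers g} := by
        intro h
        rw [← show zpowers (1 : G) = zpowers g from h] at hyg
        simp only [zpowers_one_eq_bot, mem_bot] at hyg
        exact hy (hyg ▸ dominates_one)
      rw [← ncard_generators, ← Nat.succ_le_iff, Nat.succ_eq_add_one,
        ← Set.ncard_insert_of_notMem h1 (Set.toFinite _)]
      refine Set.ncard_le_ncard ?_ (Set.toFinite _)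
      rintro v (rfl | hv)
      · exact hd.closedTwins dominates_one
      · exact closedTwins_of_zpowers_eq (Eq.symm hv)
    · exact h

theorem GeneratesMaximalCyclic.locallyLargest {g : G} (hg : GeneratesMaximalCyclic g) :
    (powerGraph G).LocallyLargest g := by
  intro y hy hdom htw
  have hyg := hg.mem_closedNbhd_iff.1 hy
  have hle := totient_orderOf_le_twinCount g
  have hle' := totient_orderOf_le_of_mem_zpowers hyg
  rcases twinCount_eq_totient_or_lt hg hyg hdom htw with h | h
  · refine ⟨by omega, fun heq z hz hzg => ?_⟩
    rw [← heq, h]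
    rcases mem_closedNbhd_powerGraph.1 hz with hz | hz
    -- A neighbour of y outside ⟨g⟩ cannot be a power of y, so y is a power of it and its class has
    -- at least φ(|y|) elements.
    · exact absurd (hg.mem_closedNbhd_iff.2 (zpowers_le.2 hyg hz)) hzg
    · exact (totient_orderOf_le_of_mem_zpowers hz).trans (totient_orderOf_le_twinCount z)
  · exact ⟨h.le, fun heq => absurd heq h.ne⟩

/-- Choose a maximal ⟨g⟩ containing x. If x and g are not twins, local maximality leaves only φ(|x|)
= φ(|g|) with |x| a proper divisor of |g|, hence |g| = 2|x| with |x| odd; the involution of ⟨g⟩ then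
violates the tie-break. -/
theorem exists_closedTwins_of_locallyLargest
    (hcyc : ¬ ∃ g : G, GeneratesMaximalCyclic g ∧ (powerGraph G).Dominates g) {x : G}
    (hdom : ¬ (powerGraph G).Dominates x) (hx : (powerGraph G).LocallyLargest x) :
    ∃ g, GeneratesMaximalCyclic g ∧ (powerGraph G).ClosedTwins x g := by
  obtain ⟨g, hg, hxg⟩ := exists_generatesMaximalCyclic x
  refine ⟨g, hg, ?_⟩
  by_contra htw
  have hgdom : ¬ (powerGraph G).Dominates g := fun h => hcyc ⟨g, hg, h⟩
  obtain ⟨hle, htie⟩ := hx g (mem_closedNbhd_powerGraph.2 (Or.inr hxg)) hgdom htw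
  have h1 := totient_orderOf_le_twinCount g
  have h2 := totient_orderOf_le_of_mem_zpowers hxg
  rcases twinCount_eq_totient_or_lt hg hxg hdom (fun h => htw h.symm) with h | h
  swap
  · omega
  have heq : (powerGraph G).twinCount g = (powerGraph G).twinCount x := by omega
  have hphi : (orderOf x).totient = (orderOf g).totient := by omega
  have hdvd := orderOf_dvd_of_mem_zpowers hxg
  have hord : orderOf x ≠ orderOf g := fun h =>
    htw (closedTwins_of_zpowers_eq (zpowers_eq_of_orderOf_eq hxg (mem_zpowers g) h))
  have h2x : 2 * orderOf x = orderOf g :=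
    (Nat.eq_or_eq_of_totient_eq_totient hdvd hphi).resolve_left hord
  have hodd : Odd (orderOf x) := by
    rw [← Nat.not_even_iff_odd]
    intro he
    have := Nat.totient_two_mul_of_even he
    rw [h2x, ← hphi] at this
    have : 0 < (orderOf x).totient := Nat.totient_pos.2 (orderOf_pos x)
    omega
  have hx1 : orderOf x ≠ 1 := fun h => hdom (orderOf_eq_one_iff.1 h ▸ dominates_one)
  -- Since |g| = 2|x|, this power of g is the involution; |x| being odd and not 1, it is not
  -- adjacent to x.
  have ht : g ^ orderOf x ∈ zpowers g := pow_mem (mem_zpowers g) _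
  have hto : orderOf (g ^ orderOf x) = 2 := by
    rw [orderOf_pow_of_dvd (orderOf_pos x).ne' hdvd, ← h2x,
      Nat.mul_div_cancel _ (orderOf_pos x)]
  have hnot : g ^ orderOf x ∉ (powerGraph G).closedNbhd x := by
    rw [mem_closedNbhd_powerGraph, mem_zpowers_iff_orderOf_dvd ht hxg,
      mem_zpowers_iff_orderOf_dvd hxg ht, hto]
    rintro (h | h)
    · exact (Nat.not_even_iff_odd.2 hodd) (even_iff_two_dvd.2 h)
    · rcases (Nat.dvd_prime Nat.prime_two).1 h with h | h
      · exact hx1 h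
      · rw [h] at hodd; exact absurd hodd (by decide)
  have hge := htie heq _ (hg.mem_closedNbhd_iff.2 ht) hnot
  rcases twinCount_eq_totient_or_lt hg ht
      (fun h => hnot (SimpleGraph.mem_closedNbhd_comm.1 (h x)))
      (fun h => hnot (by
        rw [SimpleGraph.mem_closedNbhd_comm, ← h, hg.mem_closedNbhd_iff]; exact hxg)) with h' | h'
  · rw [hto, Nat.totient_two] at h'
    have : (orderOf x).totient = 1 := by
      have : 0 < (orderOf x).totient := Nat.totient_pos.2 (orderOf_pos x)
      omega
    rcases Nat.totient_eq_one_iff.1 this with h | h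
    · exact hx1 h
    · rw [h] at hodd; exact absurd hodd (by decide)
  · omega

theorem isCoverVertex_iff {x : G} :
    (powerGraph G).IsCoverVertex x ↔
      ∃ g, GeneratesMaximalCyclic g ∧ (powerGraph G).ClosedTwins x g := by
  rw [SimpleGraph.IsCoverVertex, dominatorsPrevail_iff]
  by_cases hcyc : ∃ g : G, GeneratesMaximalCyclic g ∧ (powerGraph G).Dominates g
  · simp only [hcyc, true_and, not_true_eq_false, false_and, or_false]
    obtain ⟨g, hg, hd⟩ := hcyc
    refine ⟨fun hx => ⟨g, hg, hx.closedTwins hd⟩, ?_⟩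
    rintro ⟨k, hk, hxk⟩
    rw [hxk.dominates_iff, (closedTwins_of_zpowers_eq
      (hk.zpowers_eq (hg.mem_closedNbhd_iff.1 (hd k)))).dominates_iff]
    exact hd
  · simp only [hcyc, false_and, not_false_eq_true, true_and, false_or]
    refine ⟨fun h => exists_closedTwins_of_locallyLargest hcyc h.1 h.2, ?_⟩
    rintro ⟨g, hg, hxg⟩
    rw [hxg.dominates_iff, hxg.locallyLargest_iff]
    exact ⟨fun h => hcyc ⟨g, hg, h⟩, hg.locallyLargest⟩

/-! ### From twin classes to covering generating sets. -/

theorem isMinimalCyclicCover_setOf_maximal :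
    IsMinimalCyclicCover {C : Subgroup G | ∃ g, GeneratesMaximalCyclic g ∧ zpowers g = C} where
  cyclic := by
    rintro _ ⟨g, -, rfl⟩
    infer_instance
  cover := by
    refine Set.eq_univ_of_forall fun x => ?_
    obtain ⟨g, hg, hx⟩ := exists_generatesMaximalCyclic x
    exact Set.mem_biUnion ⟨g, hg, rfl⟩ hx
  minimal := by
    rintro _ ⟨g, hg, rfl⟩ h
    have hmem := h.symm ▸ Set.mem_univ g
    simp only [Set.mem_iUnion] at hmem
    obtain ⟨_, ⟨⟨k, hk, rfl⟩, hne⟩, hgk⟩ := hmem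
    exact hne (hg.zpowers_eq hgk).symm

theorem isCCGenerator_iff {g : G} : IsCCGenerator g ↔ GeneratesMaximalCyclic g :=
  ⟨fun ⟨_, h𝒞, hg⟩ => h𝒞.generatesMaximalCyclic hg,
    fun hg => ⟨_, isMinimalCyclicCover_setOf_maximal, g, hg, rfl⟩⟩

theorem isCCGSetUpToClosedTwins_of_transversal {S : Set G}
    (hS : ∀ s ∈ S, (powerGraph G).IsCoverVertex s)
    (hinj : ∀ s ∈ S, ∀ t ∈ S, (powerGraph G).ClosedTwins s t → s = t)
    (hsurj : ∀ x, (powerGraph G).IsCoverVertex x → ∃ s ∈ S, (powerGraph G).ClosedTwins s x) :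
    IsCCGSetUpToClosedTwins S := by
  classical
  -- The value outside `S` is irrelevant; s itself serves as a default.
  have hex : ∀ s, ∃ k, (IsCCGenerator s → k = s) ∧
      (s ∈ S → GeneratesMaximalCyclic k ∧ (powerGraph G).ClosedTwins s k) := by
    intro s
    by_cases hs : IsCCGenerator s
    · exact ⟨s, fun _ => rfl, fun _ => ⟨isCCGenerator_iff.1 hs, rfl⟩⟩
    · by_cases hsS : s ∈ S
      · obtain ⟨g, hg⟩ := isCoverVertex_iff.1 (hS s hsS)
        exact ⟨g, fun h => absurd h hs, fun _ => hg⟩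
      · exact ⟨s, fun h => absurd h hs, fun h => absurd h hsS⟩
  choose h hgen htw using hex
  have hzp : ∀ s ∈ S, ∀ t ∈ S, zpowers (h s) = zpowers (h t) → s = t := fun s hs t ht hst =>
    hinj s hs t ht (((htw s hs).2.trans (closedTwins_of_zpowers_eq hst)).trans
      (Eq.symm (htw t ht).2))
  refine ⟨h, fun s _ hs => hgen s hs,
    fun s hs _ => ⟨isCCGenerator_iff.2 (htw s hs).1, (htw s hs).2⟩,
    fun s hs t ht hst => hzp s hs t ht (by rw [hst]),
    _, isMinimalCyclicCover_setOf_maximal, ?_, ?_, ?_⟩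
  · rintro _ ⟨s, hs, rfl⟩
    exact ⟨h s, (htw s hs).1, rfl⟩
  · rintro _ ⟨s, hs, rfl⟩ _ ⟨t, ht, rfl⟩ hst
    rw [hzp s hs t ht hst]
  · rintro _ ⟨g, hg, rfl⟩
    obtain ⟨s, hs, hsg⟩ := hsurj g (isCoverVertex_iff.2 ⟨g, hg, rfl⟩)
    -- Twin maximal generators have the same closed neighbourhood, which is the subgroup each of
    -- them generates.
    refine ⟨h s, ⟨s, hs, rfl⟩, SetLike.coe_injective ?_⟩
    have := (Eq.symm (htw s hs).2).trans hsg
    ext v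
    have hv := Set.ext_iff.1 this v
    rwa [(htw s hs).1.mem_closedNbhd_iff, hg.mem_closedNbhd_iff] at hv

end PowerGraph

namespace RAM

/-! ### A term language evaluated in polynomial time -/

/-- Terms over a graph, with sums over all vertices binding named variables. -/
inductive Term : Type
  | const (c : ℕ)
  | var (v : ℕ)
  | adj (x y : Term)
  | add (x y : Term)
  | sub (x y : Term)
  | sum (v : ℕ) (x : Term)

/-- The value of a term under an assignment of the variables. -/
noncomputable def Term.eval {n : ℕ} (X : SimpleGraph (Fin n)) : Term → (ℕ → ℕ) → ℕ
  | const c, _ => c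
  | var v, ρ => ρ v
  | adj x y, ρ => adjEntry X (x.eval X ρ) (y.eval X ρ)
  | add x y, ρ => x.eval X ρ + y.eval X ρ
  | sub x y, ρ => x.eval X ρ - y.eval X ρ
  | sum v x, ρ => ∑ i ∈ Finset.range n, x.eval X (Function.update ρ v i)

/-- The content of the `0`-th cell of an array. -/
def Expr.cell (a : ℕ) : Expr := .get a (.const 0)

/-- Write to the `0`-th cell of an array. -/
def Prog.setCell (a : ℕ) (x : Expr) : Prog := .set a (.const 0) x

/-- Run `P` with the `0`-th cell of array `a` counting through all vertices. -/
def Prog.forVertices (a : ℕ) (P : Prog) : Prog :=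
  .seq (.setCell a (.const 0))
    (.while (.sub .numVertices (.cell a)) (.seq P (.setCell a (.add (.cell a) (.const 1)))))

/-- A program writing the value of a term to the `0`-th cell of array `s`. The variable `v` is read
from the `0`-th cell of array `loc v`, and the arrays below `s` are left alone. -/
def Term.compile : Term → (ℕ → ℕ) → ℕ → Prog
  | const c, _, s => .setCell s (.const c)
  | var v, loc, s => .setCell s (.cell (loc v))
  | adj x y, loc, s => .seq (x.compile loc s) (.seq (y.compile loc (s + 1))
      (.setCell s (.adj (.cell s) (.cell (s + 1)))))
  | add x y, loc, s => .seq (x.compile loc s) (.seq (y.compile loc (s + 1))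
      (.setCell s (.add (.cell s) (.cell (s + 1)))))
  | sub x y, loc, s => .seq (x.compile loc s) (.seq (y.compile loc (s + 1))
      (.setCell s (.sub (.cell s) (.cell (s + 1)))))
  | sum v x, loc, s => .seq (.setCell s (.const 0))
      (.forVertices (s + 1) (.seq (x.compile (Function.update loc v (s + 1)) (s + 2))
        (.setCell s (.add (.cell s) (.cell (s + 2))))))

/-- On input `X` and memory `σ`, the program `P` halts within `b` steps with a memory
satisfying `Q`. -/
def HaltsWithin {n : ℕ} (X : SimpleGraph (Fin n)) (P : Prog) (σ : Memory) (b : ℕ)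
    (Q : Memory → Prop) : Prop :=
  ∃ τ t, Exec X P σ τ t ∧ t ≤ b ∧ Q τ

/-! ### Running times of programs. -/

section

variable {n : ℕ} {X : SimpleGraph (Fin n)}

theorem HaltsWithin.mono {P : Prog} {σ : Memory} {b c : ℕ} {Q R : Memory → Prop}
    (h : HaltsWithin X P σ b Q) (hbc : b ≤ c) (hQR : ∀ τ, Q τ → R τ) : HaltsWithin X P σ c R := by
  obtain ⟨τ, t, h1, h2, h3⟩ := h
  exact ⟨τ, t, h1, h2.trans hbc, hQR τ h3⟩

theorem HaltsWithin.seq {P P' : Prog} {σ : Memory} {b b' : ℕ} {Q R : Memory → Prop}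
    (h : HaltsWithin X P σ b Q) (h' : ∀ τ, Q τ → HaltsWithin X P' τ b' R) :
    HaltsWithin X (.seq P P') σ (b + b') R := by
  obtain ⟨τ, t, h1, h2, h3⟩ := h
  obtain ⟨ρ, u, h4, h5, h6⟩ := h' τ h3
  exact ⟨ρ, t + u, .seq h1 h4, add_le_add h2 h5, h6⟩

theorem HaltsWithin.set (a : ℕ) (i x : Expr) (σ : Memory) :
    HaltsWithin X (.set a i x) σ (i.cost + x.cost + 1)
      (fun τ => τ = σ.write a (i.eval X σ) (x.eval X σ)) :=
  ⟨_, _, .set a i x σ, le_rfl, rfl⟩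

theorem Memory.write_self (σ : Memory) (a i x : ℕ) : σ.write a i x a i = x := by
  simp [Memory.write]

theorem Memory.write_of_index_ne (σ : Memory) (a i x : ℕ) {j : ℕ} (h : j ≠ i) :
    σ.write a i x a j = σ a j := by
  simp [Memory.write, h]

theorem Memory.write_of_ne (σ : Memory) (a i x : ℕ) {b : ℕ} (h : b ≠ a) :
    σ.write a i x b = σ b := by
  simp [Memory.write, h]

theorem HaltsWithin.setCell (a : ℕ) (x : Expr) (σ : Memory) :
    HaltsWithin X (.setCell a x) σ (x.cost + 2)
      (fun τ => τ a 0 = x.eval X σ ∧ ∀ b, b ≠ a → τ b = σ b) := by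
  refine (HaltsWithin.set a (.const 0) x σ).mono (by simp [Expr.cost]; omega) ?_
  rintro _ rfl
  exact ⟨σ.write_self _ _ _, fun b hb => σ.write_of_ne _ _ _ hb⟩

theorem Expr.eval_cell (a : ℕ) (σ : Memory) : (Expr.cell a).eval X σ = σ a 0 := rfl

/-- A loop rule with invariant `I`. The body must preserve the counter, and the next invariant must
survive any change to array `a`, because the increment happens after the body. Each round costs 11
steps beyond the body; initialisation and the last test cost 8. -/
theorem HaltsWithin.forVertices {P : Prog} {a b : ℕ} {σ : Memory} {I : ℕ → Memory → Prop}
    (h0 : ∀ τ : Memory, τ a 0 = 0 → (∀ c, c ≠ a → τ c = σ c) → I 0 τ)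
    (hstep : ∀ i τ, i < n → τ a 0 = i → I i τ →
      HaltsWithin X P τ b (fun τ' => τ' a 0 = i ∧
        ∀ ρ : Memory, ρ a 0 = i + 1 → (∀ c, c ≠ a → ρ c = τ' c) → I (i + 1) ρ)) :
    HaltsWithin X (.forVertices a P) σ (n * (b + 11) + 8) (I n) := by
  have hloop : ∀ m i τ, i + m = n → τ a 0 = i → I i τ →
      HaltsWithin X (.while (.sub .numVertices (.cell a))
        (.seq P (.setCell a (.add (.cell a) (.const 1))))) τ (m * (b + 11) + 5) (I n) := by
    intro m
    induction m with
    | zero =>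
      intro i τ him hi hI
      obtain rfl : i = n := by omega
      refine ⟨τ, _, .whileFalse ?_, ?_, hI⟩
      · simp [Expr.eval, Expr.eval_cell, hi]
      · simp [Expr.cost, Expr.cell]
    | succ m ih =>
      intro i τ him hi hI
      obtain ⟨τ', t, hP, ht, ha, hnext⟩ := hstep i τ (by omega) hi hI
      obtain ⟨ρ, u, hS, hu, hρ, hρ'⟩ :=
        HaltsWithin.setCell (X := X) a (.add (.cell a) (.const 1)) τ'
      simp only [Expr.eval, Expr.eval_cell, ha] at hρ
      obtain ⟨ω, w, hW, hw, hIn⟩ := ih (i + 1) ρ (by omega) hρ (hnext ρ hρ hρ')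
      refine ⟨ω, _, .whileTrue ?_ (.seq hP hS) hW, ?_, hIn⟩
      · simp only [Expr.eval, Expr.eval_cell, hi]; omega
      · simp only [Expr.cost, Expr.cell] at hu ⊢
        rw [Nat.succ_mul]
        omega
  refine (HaltsWithin.seq (HaltsWithin.setCell a (.const 0) σ)
    (fun τ hτ => hloop n 0 τ (by omega) hτ.1 (h0 τ hτ.1 hτ.2))).mono ?_ fun _ h => h
  simp only [Expr.cost]
  omega

theorem HaltsWithin.binary {P P' : Prog} {s b b' x y z : ℕ} {e : Expr} {σ : Memory}
    (h : HaltsWithin X P σ b (fun τ => τ s 0 = x ∧ ∀ a < s, τ a = σ a))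
    (h' : ∀ τ : Memory, (∀ a < s, τ a = σ a) →
      HaltsWithin X P' τ b' (fun ρ => ρ (s + 1) 0 = y ∧ ∀ a < s + 1, ρ a = τ a))
    (he : ∀ ρ : Memory, ρ s 0 = x → ρ (s + 1) 0 = y → e.eval X ρ = z) :
    HaltsWithin X (.seq P (.seq P' (.setCell s e))) σ (b + (b' + (e.cost + 2)))
      (fun τ => τ s 0 = z ∧ ∀ a < s, τ a = σ a) := by
  refine h.seq fun τ hτ => (h' τ hτ.2).seq fun ρ hρ =>
    (HaltsWithin.setCell s e ρ).mono le_rfl fun ω hω => ⟨?_, fun a ha => ?_⟩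
  · rw [hω.1]
    exact he ρ (by rw [hρ.2 s (by omega), hτ.1]) hρ.1
  · rw [hω.2 a ha.ne, hρ.2 a (by omega), hτ.2 a ha]

end

/-- Each sum adds one loop over the vertices, so the time bound gains one factor n. The polynomial
is chosen before `loc` and `s` because a sum compiles its body with a new variable location and a
higher scratch array. Variables live below `s`, so evaluating one operand does not disturb them for
the next. -/
theorem Term.compile_spec (x : Term) :
    ∃ p : Polynomial ℕ, ∀ (loc : ℕ → ℕ) (s : ℕ), (∀ v, loc v < s) →
      ∀ (n : ℕ) (X : SimpleGraph (Fin n)) (σ : Memory),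
        HaltsWithin X (x.compile loc s) σ (p.eval n)
          (fun τ => τ s 0 = x.eval X (fun v => σ (loc v) 0) ∧ ∀ a < s, τ a = σ a) := by
  have hbin : ∀ (x y : Term) (op : Expr → Expr → Expr) (f : ∀ n, SimpleGraph (Fin n) → ℕ → ℕ → ℕ),
      (∀ n X σ d e, (op d e).eval X σ = f n X (d.eval X σ) (e.eval X σ)) →
      (∀ d e, (op d e).cost = d.cost + e.cost + 1) →
      (∃ p : Polynomial ℕ, ∀ (loc : ℕ → ℕ) (s : ℕ), (∀ v, loc v < s) →
        ∀ (n : ℕ) (X : SimpleGraph (Fin n)) (σ : Memory),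
          HaltsWithin X (x.compile loc s) σ (p.eval n)
            (fun τ => τ s 0 = x.eval X (fun v => σ (loc v) 0) ∧ ∀ a < s, τ a = σ a)) →
      (∃ p : Polynomial ℕ, ∀ (loc : ℕ → ℕ) (s : ℕ), (∀ v, loc v < s) →
        ∀ (n : ℕ) (X : SimpleGraph (Fin n)) (σ : Memory),
          HaltsWithin X (y.compile loc s) σ (p.eval n)
            (fun τ => τ s 0 = y.eval X (fun v => σ (loc v) 0) ∧ ∀ a < s, τ a = σ a)) →
      ∃ p : Polynomial ℕ, ∀ (loc : ℕ → ℕ) (s : ℕ), (∀ v, loc v < s) →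
        ∀ (n : ℕ) (X : SimpleGraph (Fin n)) (σ : Memory),
          HaltsWithin X (.seq (x.compile loc s) (.seq (y.compile loc (s + 1))
            (.setCell s (op (.cell s) (.cell (s + 1)))))) σ (p.eval n)
            (fun τ => τ s 0 = f n X (x.eval X (fun v => σ (loc v) 0))
              (y.eval X (fun v => σ (loc v) 0)) ∧ ∀ a < s, τ a = σ a) := by
    rintro x y op f heval hcost ⟨p, hp⟩ ⟨q, hq⟩
    refine ⟨p + q + 7, fun loc s hloc n X σ => ?_⟩
    refine (HaltsWithin.binary (hp loc s hloc n X σ)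
      (fun τ hτ => (hq loc (s + 1) (fun v => (hloc v).trans s.lt_succ_self) n X τ).mono le_rfl
        (R := fun ρ => ρ (s + 1) 0 = y.eval X (fun v => σ (loc v) 0) ∧ ∀ a < s + 1, ρ a = τ a)
        fun ρ hρ => ?_)
      (fun ρ h1 h2 => by rw [heval, Expr.eval_cell, Expr.eval_cell, h1, h2])).mono ?_ fun _ h => h
    · simpa only [hτ _ (hloc _)] using hρ
    · simp only [hcost, Polynomial.eval_add, Polynomial.eval_ofNat, Expr.cost, Expr.cell]
      omega
  induction x with
  | const c =>
    refine ⟨3, fun loc s _ n X σ => (HaltsWithin.setCell s (.const c) σ).mono ?_ fun τ hτ =>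
      ⟨hτ.1, fun a ha => hτ.2 a ha.ne⟩⟩
    simp [Expr.cost]
  | var v =>
    refine ⟨4, fun loc s _ n X σ => (HaltsWithin.setCell s (.cell (loc v)) σ).mono ?_ fun τ hτ =>
      ⟨hτ.1, fun a ha => hτ.2 a ha.ne⟩⟩
    simp [Expr.cost, Expr.cell]
  | adj x y ihx ihy =>
    exact hbin x y .adj (fun _ X i j => adjEntry X i j) (fun _ _ _ _ _ => rfl) (fun _ _ => rfl)
      ihx ihy
  | add x y ihx ihy =>
    exact hbin x y .add (fun _ _ i j => i + j) (fun _ _ _ _ _ => rfl) (fun _ _ => rfl) ihx ihy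
  | sub x y ihx ihy =>
    exact hbin x y .sub (fun _ _ i j => i - j) (fun _ _ _ _ _ => rfl) (fun _ _ => rfl) ihx ihy
  | sum v x ih =>
    obtain ⟨p, hp⟩ := ih
    -- Per vertex: p for the summand, 7 for the accumulation, 11 for the loop; then 8 for the loop's
    -- start and end and 3 for clearing the accumulator.
    refine ⟨Polynomial.X * (p + 18) + 11, fun loc s hloc n X σ => ?_⟩
    have hbody : ∀ i τ, i < n → τ (s + 1) 0 = i →
        (τ s 0 = ∑ j ∈ Finset.range i, x.eval X (Function.update (fun v => σ (loc v) 0) v j) ∧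
          ∀ a < s, τ a = σ a) →
        HaltsWithin X (.seq (x.compile (Function.update loc v (s + 1)) (s + 2))
          (.setCell s (.add (.cell s) (.cell (s + 2))))) τ (p.eval n + 7)
          (fun τ' => τ' (s + 1) 0 = i ∧ ∀ ρ : Memory, ρ (s + 1) 0 = i + 1 →
            (∀ c, c ≠ s + 1 → ρ c = τ' c) →
            (ρ s 0 = ∑ j ∈ Finset.range (i + 1),
              x.eval X (Function.update (fun v => σ (loc v) 0) v j) ∧ ∀ a < s, ρ a = σ a)) := by
      rintro i τ hi hτi ⟨hacc, hlow⟩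
      have hloc' : ∀ w, Function.update loc v (s + 1) w < s + 2 := by
        intro w
        by_cases hw : w = v
        · subst hw; simp
        · rw [Function.update_of_ne hw]; have := hloc w; omega
      have henv : (fun w => τ (Function.update loc v (s + 1) w) 0) =
          Function.update (fun v => σ (loc v) 0) v i := by
        funext w
        by_cases hw : w = v
        · subst hw; simp [hτi]
        · rw [Function.update_of_ne hw, Function.update_of_ne hw, hlow _ (hloc w)]
      refine ((hp _ _ hloc' n X τ).seq fun ω hω =>
        (HaltsWithin.setCell s (.add (.cell s) (.cell (s + 2))) ω).mono
          (c := 7) (by simp [Expr.cost, Expr.cell]) fun τ' hτ' => ?_)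
      obtain ⟨hω1, hω2⟩ := hω
      obtain ⟨h1, h2⟩ := hτ'
      rw [henv] at hω1
      simp only [Expr.eval, Expr.eval_cell, hω1, hω2 s (by omega), hacc] at h1
      refine ⟨by rw [h2 _ (by omega), hω2 _ (by omega), hτi], fun ρ _ hρ => ⟨?_, fun a ha => ?_⟩⟩
      · rw [hρ s (by omega), h1, Finset.sum_range_succ]
      · rw [hρ a (by omega), h2 a (by omega), hω2 a (by omega), hlow a ha]
    refine (HaltsWithin.seq (HaltsWithin.setCell s (.const 0) σ) fun τ hτ =>
      HaltsWithin.forVertices (fun ρ _ hρ => ?_) hbody).mono ?_ fun _ h => h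
    · refine ⟨?_, fun a ha => ?_⟩
      · rw [hρ s (by omega), hτ.1]; simp [Expr.eval]
      · rw [hρ a (by omega), hτ.2 a ha.ne]
    · simp only [Expr.cost, Polynomial.eval_add, Polynomial.eval_mul, Polynomial.eval_X,
        Polynomial.eval_ofNat]
      rw [show p.eval n + 7 + 11 = p.eval n + 18 by ring]
      omega

/-- The program marking the vertices at which a term in the variable `0` is nonzero. -/
def Term.markProg (x : Term) : Prog :=
  .forVertices 1 (.seq (x.compile (fun _ => 1) 2) (.set 0 (.cell 1) (.cell 2)))

theorem Term.markProg_spec (x : Term) :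
    ∃ p : Polynomial ℕ, ∀ (n : ℕ) (X : SimpleGraph (Fin n)),
      HaltsWithin X x.markProg Memory.initial (p.eval n)
        (fun τ => τ.marked n = {v : Fin n | x.eval X (fun _ => v) ≠ 0}) := by
  obtain ⟨p, hp⟩ := x.compile_spec
  refine ⟨Polynomial.X * (p + 16) + 8, fun n X => ?_⟩
  -- Array 0 holds the output, array 1 the current vertex, and the arrays from 2 on are scratch
  -- space; every variable initially denotes the current vertex.
  refine (HaltsWithin.forVertices (b := p.eval n + 5)
    (I := fun i τ => ∀ j < i, τ 0 j = x.eval X (fun _ => j)) (fun _ _ _ _ h => by omega)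
    fun i τ hi hτ hI => ?_).mono ?_ fun τ hτ => ?_
  · refine (hp (fun _ => 1) 2 (fun _ => by omega) n X τ).seq fun ω hω =>
      (HaltsWithin.set 0 (.cell 1) (.cell 2) ω).mono (by simp [Expr.cost, Expr.cell]) ?_
    rintro _ rfl
    have h1 : ω 1 0 = i := by rw [hω.2 1 (by omega), hτ]
    rw [Expr.eval_cell, Expr.eval_cell, h1, hω.1, hτ]
    refine ⟨by rw [Memory.write_of_ne _ _ _ _ (by omega), h1], fun ρ _ hρ j hj => ?_⟩
    rw [hρ 0 (by omega)]
    by_cases hji : j = i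
    · rw [hji, Memory.write_self]
    · rw [Memory.write_of_index_ne _ _ _ _ hji, hω.2 0 (by omega), hI j (by omega)]
  · simp only [Polynomial.eval_add, Polynomial.eval_mul, Polynomial.eval_X, Polynomial.eval_ofNat]
    rw [show p.eval n + 5 + 11 = p.eval n + 16 by ring]
  · ext v
    simp only [Memory.marked, Set.mem_ofPred_eq, hτ v v.2]

end RAM

namespace RAM

/-! ### Graph conditions as terms -/

namespace Term

/-- The truth value of a term, used as a formula. -/
def Holds {n : ℕ} (X : SimpleGraph (Fin n)) (ρ : ℕ → ℕ) (x : Term) : Prop := x.eval X ρ ≠ 0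

/-- Negation, with value `0` or `1`. -/
def not (x : Term) : Term := .sub (.const 1) x

/-- Disjunction. -/
def or (x y : Term) : Term := .add x y

/-- Conjunction. -/
def and (x y : Term) : Term := .not (.or (.not x) (.not y))

/-- Implication. -/
def imp (x y : Term) : Term := .or (.not x) y

/-- Comparison of values. -/
def le (x y : Term) : Term := .not (.sub x y)

/-- Strict comparison of values. -/
def lt (x y : Term) : Term := .sub y x

/-- Equality of values. -/
def eq (x y : Term) : Term := .and (.le x y) (.le y x)

/-- Universal quantification over the vertices. -/
def all (v : ℕ) (x : Term) : Term := .not (.sum v (.not x))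

/-- The vertex `b` is in the closed neighbourhood of the vertex `a`. -/
def near (a b : ℕ) : Term := .or (.eq (.var b) (.var a)) (.adj (.var a) (.var b))

/-- The vertices `a` and `b` are closed twins. The variable `10` is bound. -/
def twins (a b : ℕ) : Term :=
  .all 10 (.and (.imp (.near a 10) (.near b 10)) (.imp (.near b 10) (.near a 10)))

/-- The vertex `a` is dominating. -/
def dominates (a : ℕ) : Term := .all 10 (.near a 10)

/-- The size of the twin class of `a`. The variables `10` and `11` are bound. -/
def twinCount (a : ℕ) : Term := .sum 11 (.not (.not (.twins a 11)))

/-- See `SimpleGraph.DominatorsPrevail`. -/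
def dominatorsPrevail : Term :=
  .all 1 (.all 2 (.imp (.dominates 1) (.imp (.not (.dominates 2))
    (.lt (.twinCount 2) (.twinCount 1)))))

/-- See `SimpleGraph.LocallyLargest`, for the vertex `0`. -/
def locallyLargest : Term :=
  .all 1 (.imp (.near 0 1) (.imp (.not (.dominates 1)) (.imp (.not (.twins 0 1))
    (.and (.le (.twinCount 1) (.twinCount 0)) (.imp (.eq (.twinCount 1) (.twinCount 0))
      (.all 2 (.imp (.near 1 2) (.imp (.not (.near 0 2))
        (.le (.twinCount 0) (.twinCount 2))))))))))

/-- See `SimpleGraph.IsCoverVertex`, for the vertex `0`. -/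
def isCoverVertex : Term :=
  .or (.and .dominatorsPrevail (.dominates 0))
    (.and (.not .dominatorsPrevail) (.and (.not (.dominates 0)) .locallyLargest))

/-- The vertex `0` is a cover vertex and comes first in its twin class. -/
def isFirstCoverVertex : Term :=
  .and .isCoverVertex (.all 3 (.imp (.lt (.var 3) (.var 0)) (.not (.twins 3 0))))

/-! ### Meaning of the formulas. -/

section

variable {n : ℕ} {X : SimpleGraph (Fin n)} {ρ : ℕ → ℕ} {x y : Term}

theorem holds_not : Holds X ρ (.not x) ↔ ¬ Holds X ρ x := by
  simp only [Holds, Term.not, Term.eval]; omega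

theorem holds_or : Holds X ρ (.or x y) ↔ Holds X ρ x ∨ Holds X ρ y := by
  simp only [Holds, Term.or, Term.eval]; omega

theorem holds_and : Holds X ρ (.and x y) ↔ Holds X ρ x ∧ Holds X ρ y := by
  simp only [Term.and, holds_not, holds_or]; tauto

theorem holds_imp : Holds X ρ (.imp x y) ↔ (Holds X ρ x → Holds X ρ y) := by
  simp only [Term.imp, holds_not, holds_or]; tauto

theorem holds_le : Holds X ρ (.le x y) ↔ x.eval X ρ ≤ y.eval X ρ := by
  simp only [Holds, Term.le, Term.not, Term.eval]; omega

theorem holds_lt : Holds X ρ (.lt x y) ↔ x.eval X ρ < y.eval X ρ := by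
  simp only [Holds, Term.lt, Term.eval]; omega

theorem holds_eq : Holds X ρ (.eq x y) ↔ x.eval X ρ = y.eval X ρ := by
  rw [Term.eq, holds_and, holds_le, holds_le, le_antisymm_iff]

/-- The sum counts counterexamples, so it vanishes exactly when there are none. -/
theorem holds_all {v : ℕ} :
    Holds X ρ (.all v x) ↔ ∀ i : Fin n, Holds X (Function.update ρ v i) x := by
  rw [Term.all, holds_not]
  simp only [Holds, Term.eval, ne_eq, not_not, Finset.sum_eq_zero_iff, Finset.mem_range]
  refine ⟨fun h i => ?_, fun h i hi => ?_⟩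
  · exact not_not.1 (mt holds_not.2 (not_not.2 (h i i.2)))
  · exact not_not.1 (mt holds_not.1 (not_not.2 (h ⟨i, hi⟩)))

theorem holds_near {a b : ℕ} {i j : Fin n} (ha : ρ a = i) (hb : ρ b = j) :
    Holds X ρ (.near a b) ↔ j ∈ X.closedNbhd i := by
  rw [Term.near, holds_or, holds_eq, SimpleGraph.mem_closedNbhd]
  simp only [Holds, Term.eval]
  rw [ha, hb]
  simp [adjEntry, Fin.ext_iff]

/-- The side conditions prevent capture by the bound variable `10`. -/
theorem holds_twins {a b : ℕ} {i j : Fin n} (ha : ρ a = i) (hb : ρ b = j) (ha' : a ≠ 10)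
    (hb' : b ≠ 10) : Holds X ρ (.twins a b) ↔ X.ClosedTwins i j := by
  rw [Term.twins, holds_all, SimpleGraph.ClosedTwins, Set.ext_iff]
  refine forall_congr' fun k => ?_
  rw [← Function.update_of_ne ha' (k : ℕ) ρ] at ha
  rw [← Function.update_of_ne hb' (k : ℕ) ρ] at hb
  have hk := Function.update_self 10 (k : ℕ) ρ
  rw [holds_and, holds_imp, holds_imp, holds_near ha hk, holds_near hb hk]
  exact iff_def.symm

theorem holds_dominates {a : ℕ} {i : Fin n} (ha : ρ a = i) (ha' : a ≠ 10) :
    Holds X ρ (.dominates a) ↔ X.Dominates i := by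
  rw [Term.dominates, holds_all]
  refine forall_congr' fun k => ?_
  rw [← Function.update_of_ne ha' (k : ℕ) ρ] at ha
  exact holds_near ha (Function.update_self 10 (k : ℕ) ρ)

/-- The double negation normalises truth values to 0 or 1, so that the sum counts twins. -/
theorem eval_twinCount {a : ℕ} {i : Fin n} (ha : ρ a = i) (ha' : a ≠ 10) (ha'' : a ≠ 11) :
    (Term.twinCount a).eval X ρ = X.twinCount i := by
  classical
  rw [Term.twinCount, Term.eval, Finset.sum_range, SimpleGraph.twinCount,
    Set.ncard_eq_toFinset_card', Set.toFinset_ofPred, Finset.card_filter]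
  refine Finset.sum_congr rfl fun k _ => ?_
  rw [← Function.update_of_ne ha'' (k : ℕ) ρ] at ha
  have h := holds_twins (X := X) ha (Function.update_self 11 (k : ℕ) ρ) ha' (by decide)
  simp only [Holds] at h
  simp only [Term.not, Term.eval]
  split_ifs with hk
  · have := h.2 hk; omega
  · have := mt h.1 hk; omega

theorem holds_dominatorsPrevail : Holds X ρ .dominatorsPrevail ↔ X.DominatorsPrevail := by
  rw [Term.dominatorsPrevail, holds_all]
  refine forall_congr' fun u => ?_
  rw [holds_all]
  refine forall_congr' fun y => ?_
  have h1 : Function.update (Function.update ρ 1 u) 2 y 1 = u := by simp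
  have h2 : Function.update (Function.update ρ 1 u) 2 y 2 = y := by simp
  rw [holds_imp, holds_imp, holds_not, holds_lt, holds_dominates h1 (by decide),
    holds_dominates h2 (by decide), eval_twinCount h1 (by decide) (by decide),
    eval_twinCount h2 (by decide) (by decide)]

theorem holds_locallyLargest {i : Fin n} (h : ρ 0 = i) :
    Holds X ρ .locallyLargest ↔ X.LocallyLargest i := by
  rw [Term.locallyLargest, holds_all]
  refine forall_congr' fun y => ?_
  have h0 : Function.update ρ 1 y 0 = i := by simp [h]
  have h1 : Function.update ρ 1 y 1 = y := by simp
  rw [holds_imp, holds_imp, holds_imp, holds_and, holds_imp, holds_not, holds_not, holds_le,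
    holds_eq, holds_near h0 h1, holds_dominates h1 (by decide),
    holds_twins h0 h1 (by decide) (by decide), eval_twinCount h0 (by decide) (by decide),
    eval_twinCount h1 (by decide) (by decide), holds_all]
  refine imp_congr_right fun _ => imp_congr_right fun _ => imp_congr_right fun _ =>
    and_congr_right fun _ => imp_congr_right fun _ => forall_congr' fun z => ?_
  have h0' : Function.update (Function.update ρ 1 y) 2 z 0 = i := by simp [h]
  have h1' : Function.update (Function.update ρ 1 y) 2 z 1 = y := by simp
  have h2' : Function.update (Function.update ρ 1 y) 2 z 2 = z := by simp
  rw [holds_imp, holds_imp, holds_not, holds_le, holds_near h1' h2', holds_near h0' h2',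
    eval_twinCount h0' (by decide) (by decide), eval_twinCount h2' (by decide) (by decide)]

theorem holds_isCoverVertex {i : Fin n} (h : ρ 0 = i) :
    Holds X ρ .isCoverVertex ↔ X.IsCoverVertex i := by
  rw [Term.isCoverVertex, holds_or, holds_and, holds_and, holds_and, holds_not, holds_not,
    holds_dominatorsPrevail, holds_dominates h (by decide), holds_locallyLargest h]
  rfl

theorem holds_isFirstCoverVertex {i : Fin n} (h : ρ 0 = i) :
    Holds X ρ .isFirstCoverVertex ↔ X.IsCoverVertex i ∧ ∀ j < i, ¬ X.ClosedTwins j i := by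
  rw [Term.isFirstCoverVertex, holds_and, holds_isCoverVertex h, holds_all]
  refine and_congr_right fun _ => forall_congr' fun j => ?_
  have h0 : Function.update ρ 3 j 0 = i := by simp [h]
  have h3 : Function.update ρ 3 j 3 = j := by simp
  rw [holds_imp, holds_lt, holds_not, holds_twins h3 h0 (by decide) (by decide), Term.eval,
    Term.eval, h0, h3, Fin.lt_def]

end

end Term

end RAM

/-! ### Invariance under graph isomorphism, and the main theorem. -/

namespace SimpleGraph.Iso

variable {V W : Type*} {X : SimpleGraph V} {Y : SimpleGraph W} (e : X ≃g Y)

theorem mem_closedNbhd_iff {u v : V} : e v ∈ Y.closedNbhd (e u) ↔ v ∈ X.closedNbhd u := by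
  rw [mem_closedNbhd, mem_closedNbhd, e.map_adj_iff, e.injective.eq_iff]

theorem closedTwins_iff {u v : V} : Y.ClosedTwins (e u) (e v) ↔ X.ClosedTwins u v := by
  simp only [ClosedTwins, Set.ext_iff, e.surjective.forall, e.mem_closedNbhd_iff]

theorem dominates_iff {u : V} : Y.Dominates (e u) ↔ X.Dominates u := by
  simp only [Dominates, e.surjective.forall, e.mem_closedNbhd_iff]

theorem twinCount_eq (u : V) : Y.twinCount (e u) = X.twinCount u := by
  rw [twinCount, twinCount, ← Set.ncard_image_of_injective _ e.injective]
  congr 1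
  ext w
  obtain ⟨v, rfl⟩ := e.surjective w
  simp [e.closedTwins_iff]

theorem isCoverVertex_iff {u : V} : Y.IsCoverVertex (e u) ↔ X.IsCoverVertex u := by
  simp only [IsCoverVertex, DominatorsPrevail, LocallyLargest, e.surjective.forall,
    e.mem_closedNbhd_iff, e.closedTwins_iff, e.dominates_iff, e.twinCount_eq]

end SimpleGraph.Iso

theorem mainTheorem2 :
    ∃ (P : RAM.Prog) (p : Polynomial ℕ),
      ∀ (G : Type*) [Group G] [Finite G] (n : ℕ) (X : SimpleGraph (Fin n))
        (e : powerGraph G ≃g X),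
        ∃ (τ : RAM.Memory) (t : ℕ),
          RAM.Exec X P RAM.Memory.initial τ t ∧
          t ≤ p.eval n ∧
          IsCCGSetUpToClosedTwins (e ⁻¹' τ.marked n) := by
  obtain ⟨p, hp⟩ := RAM.Term.isFirstCoverVertex.markProg_spec
  refine ⟨RAM.Term.isFirstCoverVertex.markProg, p, fun G _ _ n X e => ?_⟩
  obtain ⟨τ, t, hexec, ht, hτ⟩ := hp n X
  have hmem : ∀ x, x ∈ e ⁻¹' τ.marked n ↔
      X.IsCoverVertex (e x) ∧ ∀ j < e x, ¬ X.ClosedTwins j (e x) := fun x => by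
    rw [hτ]
    exact RAM.Term.holds_isFirstCoverVertex rfl
  refine ⟨τ, t, hexec, ht, isCCGSetUpToClosedTwins_of_transversal ?_ ?_ ?_⟩
  · exact fun x hx => e.isCoverVertex_iff.1 ((hmem x).1 hx).1
  · intro x hx y hy hxy
    have h := e.closedTwins_iff.2 hxy
    refine e.injective (le_antisymm (not_lt.1 fun hlt => ?_) (not_lt.1 fun hlt => ?_))
    · exact ((hmem x).1 hx).2 _ hlt (Eq.symm h)
    · exact ((hmem y).1 hy).2 _ hlt h
  · intro x hx
    -- The least vertex of the class is the marked one; it is again a cover vertex because it is a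
    -- twin of the same maximal generator.
    obtain ⟨i, hi, hmin⟩ := Set.exists_min_image {i : Fin n | X.ClosedTwins i (e x)} id
      (Set.toFinite _) ⟨e x, rfl⟩
    obtain ⟨y, rfl⟩ := e.surjective i
    have hyx : (powerGraph G).ClosedTwins y x := e.closedTwins_iff.1 hi
    refine ⟨y, (hmem y).2 ⟨?_, fun j hj hjy => ?_⟩, hyx⟩
    · obtain ⟨g, hg, hxg⟩ := isCoverVertex_iff.1 hx
      exact e.isCoverVertex_iff.2 (isCoverVertex_iff.2 ⟨g, hg, hyx.trans hxg⟩)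
    · exact absurd (hmin j (Eq.trans hjy hi)) (not_le.2 hj)
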